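/- Let $c,n\ge 1$ be the numbers of labels and of data points, let $D$ be a probability distribution on $\mathcal X\times\{-1,+1\}^c$, and let $S=\{(\mathbf x_i,\mathbf y_i)\}_{i=1}^n\sim D^n$ be an i.i.d. sample. Let $\kappa:\mathcal X\times\mathcal X\to\mathbb R$ be a positive semidefinite kernel with $\kappa(\mathbf x,\mathbf x)\le r^2$ for all $\mathbf x\in\mathcal X$, where $r>0$, let $\phi:\mathcal X\to\mathbb H$ be a (strongly measurable) feature map of $\kappa$ into a real Hilbert space $\mathbb H$ (for instance the reproducing kernel Hilbert space of $\kappa$), so that $\kappa(\mathbf x,\mathbf x')=\langle\phi(\mathbf x),\phi(\mathbf x')\rangle$, and for $\Lambda\in\mathbb R$ let $$\mathcal F=\Big\{\mathbf x\mapsto\big(\langle \mathbf w_1,\phi(\mathbf x)\rangle,\dots,\langle \mathbf w_c,\phi(\mathbf x)\rangle\big)\;:\;\Big(\sum_{j=1}^c\|\mathbf w_j\|^2\Big)^{1/2}\le\Lambda\Big\}.$$ Let the base loss $\ell:\mathbb R\to\mathbb R$ satisfy $\ell(u)\ge[\![u\le 0]\!]$ for all $u$, let $\ell$ be $\rho$-Lipschitz,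 and let it be bounded by $B$ in the sense that $\ell(f_p(\mathbf x)-f_q(\mathbf x))\le B$ for all $f\in\mathcal F$, $\mathbf x\in\mathcal X$ and labels $p,q$. For $\mathbf y\in\{-1,+1\}^c$ put $Y^{\pm}=\{j: y_j=\pm1\}$, and define the $0/1$ ranking loss and the surrogate ranking loss by $$L_r^{0/1}(f(\mathbf x),\mathbf y)=\frac1{|Y^+||Y^-|}\sum_{p\in Y^+}\sum_{q\in Y^-}[\![f_p(\mathbf x)\le f_q(\mathbf x)]\!],\qquad L_r(f(\mathbf x),\mathbf y)=\frac1{|Y^+||Y^-|}\sum_{p\in Y^+}\sum_{q\in Y^-}\ell\big(f_p(\mathbf x)-f_q(\mathbf x)\big)$$ (both are $0$ if $Y^+$ or $Y^-$ is empty). Let $R^r_{0/1}(f)=\mathbb E_{(\mathbf x,\mathbf y)\sim D}[L_r^{0/1}(f(\mathbf x),\mathbf y)]$ and $\hat R^r_S(f)=\frac1n\sum_{i=1}^nL_r(f(\mathbf x_i),\mathbf y_i)$. Then for every $\delta>0$, with probability at least $1-\delta$ over the draw of $S$, the following holds for all $f\in\mathcal F$ simultaneously: $$R^r_{0/1}(f)\le\hat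 R^r_S(f)+2\sqrt2\,\rho\sqrt{\frac{c\Lambda^2r^2}{n}}+3B\sqrt{\frac{\log\frac2\delta}{2n}}.$$ The hinge loss $\ell(u)=\max(0,1-u)$, with $\rho=1$, is admitted, which gives a generalization bound for Rank-SVM. -/

import Mathlib

open MeasureTheory
open scoped NNReal

namespace MultiLabel

/-- Label vectors `y ∈ {-1, +1}^c`; `ℤˣ` is the two-element set `{-1, +1}`. -/
abbrev Label (c : ℕ) : Type := Fin c → ℤˣ

/-- The index set `Y⁺` of the relevant labels of `y`. -/
def relevant {c : ℕ} (y : Label c) : Finset (Fin c) :=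
  Finset.univ.filter fun j => y j = 1

/-- The index set `Y⁻` of the irrelevant labels of `y`. -/
def irrelevant {c : ℕ} (y : Label c) : Finset (Fin c) :=
  Finset.univ.filter fun j => y j = -1

/-- The `0/1` ranking loss of the score vector `s` at the label vector `y`. It is `0` (an empty
sum) when `y` has no relevant or no irrelevant label. -/
noncomputable def rankingLoss01 {c : ℕ} (s : Fin c → ℝ) (y : Label c) : ℝ :=
  (1 / (((relevant y).card : ℝ) * ((irrelevant y).card : ℝ))) *
    ∑ p ∈ relevant y, ∑ q ∈ irrelevant y, if s p ≤ s q then (1 : ℝ) else 0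

/-- The surrogate ranking loss `L_r` with base loss `ℓ`. It is `0` (an empty sum) when `y` has
no relevant or no irrelevant label. -/
noncomputable def surrogateRankingLoss {c : ℕ} (ℓ : ℝ → ℝ) (s : Fin c → ℝ) (y : Label c) : ℝ :=
  (1 / (((relevant y).card : ℝ) * ((irrelevant y).card : ℝ))) *
    ∑ p ∈ relevant y, ∑ q ∈ irrelevant y, ℓ (s p - s q)

/-- The true expected `0/1` ranking risk of the score function `f` under the distribution `D`. -/
noncomputable def rankingRisk01 {𝒳 : Type*} [MeasurableSpace 𝒳] {c : ℕ}
    (D : Measure (𝒳 × Label c)) (f : 𝒳 → Fin c → ℝ) : ℝ :=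
  ∫ z, rankingLoss01 (f z.1) z.2 ∂D

/-- The empirical surrogate ranking risk of `f` on the sample `S` of size `n`. -/
noncomputable def empiricalRankingRisk {𝒳 : Type*} {c n : ℕ} (ℓ : ℝ → ℝ)
    (S : Fin n → 𝒳 × Label c) (f : 𝒳 → Fin c → ℝ) : ℝ :=
  (1 / (n : ℝ)) * ∑ i, surrogateRankingLoss ℓ (f (S i).1) (S i).2

/-- `φ : 𝒳 → H` is a feature map of the kernel `κ`. -/
def IsFeatureMap {𝒳 H : Type*} [NormedAddCommGroup H] [InnerProductSpace ℝ H]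
    (κ : 𝒳 → 𝒳 → ℝ) (φ : 𝒳 → H) : Prop :=
  ∀ x x', κ x x' = inner ℝ (φ x) (φ x')

/-- The kernel-based hypothesis set
`{x ↦ (⟪w_1, φ x⟫, …, ⟪w_c, φ x⟫) : (∑ j, ‖w_j‖²)^(1/2) ≤ Λ}`. -/
def kernelClass {𝒳 H : Type*} [NormedAddCommGroup H] [InnerProductSpace ℝ H]
    (c : ℕ) (φ : 𝒳 → H) (Λ : ℝ) : Set (𝒳 → Fin c → ℝ) :=
  {f | ∃ W : Fin c → H, √(∑ j, ‖W j‖ ^ 2) ≤ Λ ∧ f = fun x j => inner ℝ (W j) (φ x)}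

end MultiLabel

namespace MultiLabel

/-! The surrogate loss dominates the 0/1 loss, so a one-sided uniform deviation bound for the
surrogate is enough. Replacing one data point moves the supremal deviation (scaled by `n`) by at
most `B`; McDiarmid's inequality concentrates it around its mean, and symmetrization bounds that
mean by Rademacher sums.

The Rademacher sums are controlled by `sum_signs_iSup_le`. At a fixed label vector the loss is an
average of `ℓ` over label pairs, and a score difference is an inner product of the joint weight
vector with a vector of squared norm at most `2 * r ^ 2`. Replacing each loss by these linear forms,
one sign at a time, gives `Λ * √(n * (2 * (ρ * r) ^ 2))` with no dependence on `c`. The stated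
constants follow by weakening.

Suprema must be measurable: strong measurability of `φ` reduces to a separable feature space, where
a dense sequence of weights suffices by continuity. -/

/-! ### Bounded differences inequality -/

theorem integral_pi_succ_eq_integral_prod {Z : Type*} [MeasurableSpace Z] (D : Measure Z)
    [IsProbabilityMeasure D] {n : ℕ} (F : (Fin (n + 1) → Z) → ℝ) :
    ∫ S, F S ∂Measure.pi (fun _ => D) =
      ∫ p : Z × (Fin n → Z), F (Fin.cons p.1 p.2) ∂(D.prod (Measure.pi fun _ => D)) := by
  have h := (measurePreserving_piFinSuccAbove (fun _ : Fin (n + 1) => D) 0).symm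
  rw [← h.integral_comp']
  congr 1 with p
  exact congrArg F (Fin.insertNth_zero' p.1 p.2)

theorem measurable_fin_cons {Z : Type*} [MeasurableSpace Z] {n : ℕ} :
    Measurable fun p : Z × (Fin n → Z) => (Fin.cons p.1 p.2 : Fin (n + 1) → Z) := by
  refine measurable_pi_iff.2 (Fin.cases ?_ fun i => ?_)
  · simpa using measurable_fst
  · simpa [Function.comp_def] using
      (measurable_pi_apply i).comp (measurable_snd (α := Z) (β := Fin n → Z))

theorem integrable_of_measurable_of_abs_le {Z : Type*} [MeasurableSpace Z] {D : Measure Z}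
    [IsFiniteMeasure D] {f : Z → ℝ} (hf : Measurable f) {C : ℝ} (hC : ∀ z, |f z| ≤ C) :
    Integrable f D :=
  Integrable.of_bound hf.aestronglyMeasurable C (Filter.Eventually.of_forall hC)

theorem abs_integral_le_of_abs_le {Z : Type*} [MeasurableSpace Z] (D : Measure Z)
    [IsProbabilityMeasure D] {f : Z → ℝ} {C : ℝ} (hC : ∀ z, |f z| ≤ C) : |∫ z, f z ∂D| ≤ C := by
  simpa using norm_integral_le_of_norm_le_const (μ := D) (f := f) (C := C)
    (Filter.Eventually.of_forall hC)

/-- Exponential moment bound for a function of independent variables with bounded differences. -/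
theorem integral_exp_sub_integral_le_of_bounded_differences {Z : Type*} [MeasurableSpace Z]
    (D : Measure Z) [IsProbabilityMeasure D] {B : ℝ} (hB : 0 ≤ B) (t : ℝ) :
    ∀ (n : ℕ) (G : (Fin n → Z) → ℝ) (_ : Measurable G) (C : ℝ) (_ : ∀ S, |G S| ≤ C)
      (_ : ∀ S i z, |G (Function.update S i z) - G S| ≤ B),
      ∫ S, Real.exp (t * (G S - ∫ S', G S' ∂Measure.pi fun _ => D)) ∂Measure.pi (fun _ => D) ≤
        Real.exp (n * ((B / 2) ^ 2 * t ^ 2 / 2)) := by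
  intro n
  induction n with
  | zero =>
    intro G hG C hC hd
    have : ∀ S, G S = G default := fun S => congrArg G (Subsingleton.elim _ _)
    simp [this]
  | succ n ih =>
    intro G hG C hC hd
    have hZ : Nonempty Z := nonempty_of_isProbabilityMeasure D
    have hGm : Measurable fun p : Z × (Fin n → Z) => G (Fin.cons p.1 p.2) :=
      hG.comp measurable_fin_cons
    -- Averaging out the first coordinate preserves the mean and the bounded differences, so the
    -- induction hypothesis applies to `g`.
    set g : (Fin n → Z) → ℝ := fun S => ∫ z, G (Fin.cons z S) ∂D with hg
    have hgm : Measurable g := by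
      have : StronglyMeasurable fun p : Z × (Fin n → Z) => G (Fin.cons p.1 p.2) :=
        hGm.stronglyMeasurable
      exact this.integral_prod_left'.measurable
    have hslice : ∀ S : Fin n → Z, Measurable fun z => G (Fin.cons z S) := fun S =>
      hGm.comp (measurable_id.prodMk measurable_const)
    have hsint : ∀ S : Fin n → Z, Integrable (fun z => G (Fin.cons z S)) D := fun S =>
      integrable_of_measurable_of_abs_le (hslice S) fun z => hC _
    have hgC : ∀ S, |g S| ≤ C := fun S => abs_integral_le_of_abs_le D fun z => hC _
    have hgd : ∀ S i z, |g (Function.update S i z) - g S| ≤ B := fun S i z => by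
      have h1 : g (Function.update S i z) - g S =
          ∫ z', (G (Fin.cons z' (Function.update S i z)) - G (Fin.cons z' S)) ∂D :=
        (integral_sub (hsint _) (hsint _)).symm
      rw [h1]
      refine abs_integral_le_of_abs_le D fun z' => ?_
      have := hd (Fin.cons z' S) i.succ z
      rwa [← Fin.cons_update] at this
    have hGint : Integrable (fun p : Z × (Fin n → Z) => G (Fin.cons p.1 p.2))
        (D.prod (Measure.pi fun _ => D)) :=
      integrable_of_measurable_of_abs_le hGm fun p => hC _
    have hmean : ∫ S, G S ∂Measure.pi (fun _ => D) = ∫ S, g S ∂Measure.pi (fun _ => D) := by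
      rw [integral_pi_succ_eq_integral_prod, integral_prod_symm _ hGint]
    rw [hmean]
    set m := ∫ S, g S ∂Measure.pi (fun _ : Fin n => D) with hm
    have hexpint : ∀ {W : Type _} [MeasurableSpace W] (ν : Measure W) [IsFiniteMeasure ν]
        (f : W → ℝ), Measurable f → (∀ w, |f w| ≤ C) → ∀ a : ℝ,
        Integrable (fun w => Real.exp (t * (f w - a))) ν := by
      intro W _ ν _ f hf hfC a
      refine integrable_of_measurable_of_abs_le (C := Real.exp (|t| * (C + |a|)))
        (((hf.sub_const a).const_mul t).exp) fun w => ?_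
      rw [Real.abs_exp]
      refine Real.exp_le_exp.2 ((le_abs_self _).trans ?_)
      rw [abs_mul]
      exact mul_le_mul_of_nonneg_left ((abs_sub _ _).trans (by linarith [hfC w])) (abs_nonneg t)
    have hslice_bound : ∀ S : Fin n → Z, ∫ z, Real.exp (t * (G (Fin.cons z S) - g S)) ∂D ≤
        Real.exp ((B / 2) ^ 2 * t ^ 2 / 2) := fun S => by
      -- With the other coordinates fixed, `G` ranges in an interval of length `B` starting at its
      -- infimum, so Hoeffding's lemma applies with variance proxy `(B / 2) ^ 2`.
      have hbdd : BddBelow (Set.range fun z => G (Fin.cons z S)) :=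
        ⟨-C, by rintro _ ⟨z, rfl⟩; exact (abs_le.1 (hC _)).1⟩
      have hmem : ∀ᵐ z ∂D, G (Fin.cons z S) ∈
          Set.Icc (⨅ z, G (Fin.cons z S)) ((⨅ z, G (Fin.cons z S)) + B) := by
        refine Filter.Eventually.of_forall fun z => ⟨ciInf_le hbdd z, ?_⟩
        have : G (Fin.cons z S) - B ≤ ⨅ z, G (Fin.cons z S) := le_ciInf fun z' => by
          have := hd (Fin.cons z' S) 0 z
          rw [Fin.update_cons_zero] at this
          linarith [(abs_le.1 this).2]
        linarith
      have := (ProbabilityTheory.hasSubgaussianMGF_of_mem_Icc (hslice S).aemeasurable hmem).mgf_le t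
      simpa [ProbabilityTheory.mgf, abs_of_nonneg hB] using this
    calc ∫ S, Real.exp (t * (G S - m)) ∂Measure.pi (fun _ => D)
        = ∫ p : Z × (Fin n → Z), Real.exp (t * (G (Fin.cons p.1 p.2) - m))
            ∂(D.prod (Measure.pi fun _ => D)) := integral_pi_succ_eq_integral_prod _ _
      _ = ∫ S, ∫ z, Real.exp (t * (G (Fin.cons z S) - m)) ∂D ∂Measure.pi (fun _ => D) :=
          integral_prod_symm _ (hexpint _ _ hGm (fun _ => hC _) m)
      _ = ∫ S, (∫ z, Real.exp (t * (G (Fin.cons z S) - g S)) ∂D) * Real.exp (t * (g S - m))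
            ∂Measure.pi (fun _ => D) := by
          congr 1 with S
          rw [← integral_mul_const]
          congr 1 with z
          rw [← Real.exp_add]
          congr 1
          ring
      _ ≤ ∫ S, Real.exp ((B / 2) ^ 2 * t ^ 2 / 2) * Real.exp (t * (g S - m))
            ∂Measure.pi (fun _ => D) := by
          refine integral_mono_of_nonneg
            (Filter.Eventually.of_forall fun S => mul_nonneg
              (integral_nonneg fun z => (Real.exp_pos _).le) (Real.exp_pos _).le)
            ((hexpint _ _ hgm hgC m).const_mul _)
            (Filter.Eventually.of_forall fun S =>
              mul_le_mul_of_nonneg_right (hslice_bound S) (Real.exp_pos _).le)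
      _ = Real.exp ((B / 2) ^ 2 * t ^ 2 / 2) *
            ∫ S, Real.exp (t * (g S - m)) ∂Measure.pi (fun _ => D) := integral_const_mul _ _
      _ ≤ Real.exp ((B / 2) ^ 2 * t ^ 2 / 2) * Real.exp (n * ((B / 2) ^ 2 * t ^ 2 / 2)) :=
          mul_le_mul_of_nonneg_left (ih g hgm C hgC hgd) (Real.exp_pos _).le
      _ = Real.exp ((n + 1 : ℕ) * ((B / 2) ^ 2 * t ^ 2 / 2)) := by
          rw [← Real.exp_add]
          congr 1
          push_cast
          ring

/-- **McDiarmid's inequality**: the upper tail of a function of independent variables with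
bounded differences. -/
theorem measure_le_sub_integral_le_of_bounded_differences {Z : Type*} [MeasurableSpace Z]
    (D : Measure Z) [IsProbabilityMeasure D] {n : ℕ} (hn : 1 ≤ n) {B : ℝ} (hB : 0 < B)
    {G : (Fin n → Z) → ℝ} (hG : Measurable G) {C : ℝ} (hC : ∀ S, |G S| ≤ C)
    (hd : ∀ S i z, |G (Function.update S i z) - G S| ≤ B) {ε : ℝ} (hε : 0 ≤ ε) :
    (Measure.pi fun _ : Fin n => D).real
        {S | ε ≤ G S - ∫ S', G S' ∂Measure.pi fun _ => D} ≤
      Real.exp (-2 * ε ^ 2 / (n * B ^ 2)) := by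
  have hn' : (0 : ℝ) < n := by exact_mod_cast hn
  have hsub : ProbabilityTheory.HasSubgaussianMGF
      (fun S => G S - ∫ S', G S' ∂Measure.pi fun _ => D)
      (Real.toNNReal (n * (B / 2) ^ 2)) (Measure.pi fun _ : Fin n => D) := by
    refine ⟨fun t => ProbabilityTheory.integrable_exp_mul_of_mem_Icc
      (a := -C - ∫ S', G S' ∂Measure.pi fun _ => D) (b := C - ∫ S', G S' ∂Measure.pi fun _ => D)
      (hG.sub_const _).aemeasurable (Filter.Eventually.of_forall fun S => ?_), fun t => ?_⟩
    · have := abs_le.1 (hC S)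
      constructor <;> linarith [this.1, this.2]
    · refine (integral_exp_sub_integral_le_of_bounded_differences D hB.le t n G hG C hC hd).trans
        (le_of_eq ?_)
      congr 1
      rw [Real.coe_toNNReal _ (by positivity)]
      ring
  refine (hsub.measure_ge_le hε).trans (le_of_eq ?_)
  congr 1
  rw [Real.coe_toNNReal _ (by positivity)]
  field_simp

/-! ### Symmetrization -/

theorem bddAbove_range_of_abs_le {ι : Type*} {f : ι → ℝ} {C : ℝ} (h : ∀ k, |f k| ≤ C) :
    BddAbove (Set.range f) :=
  ⟨C, by rintro _ ⟨k, rfl⟩; exact (abs_le.1 (h k)).2⟩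

theorem abs_ciSup_le {ι : Type*} [Nonempty ι] {f : ι → ℝ} {C : ℝ} (h : ∀ k, |f k| ≤ C) :
    |⨆ k, f k| ≤ C :=
  abs_le.2 ⟨(abs_le.1 (h (Classical.arbitrary ι))).1.trans
    (le_ciSup (bddAbove_range_of_abs_le h) _), ciSup_le fun k => (abs_le.1 (h k)).2⟩

/-- The supremum over the class `g` of the sums on the sample `S`, signed by `ε`. -/
noncomputable def signedSup {Z ι : Type*} {n : ℕ} (g : ι → Z → ℝ) (ε : Fin n → ℤˣ)
    (S : Fin n → Z) : ℝ :=
  ⨆ k, ∑ i, ((ε i : ℤ) : ℝ) * g k (S i)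

theorem abs_intUnit_mul (u : ℤˣ) (x : ℝ) : |((u : ℤ) : ℝ) * x| = |x| := by
  rcases Int.units_eq_one_or u with rfl | rfl <;> simp

theorem abs_sum_le_of_abs_le {n : ℕ} {f : Fin n → ℝ} {C : ℝ} (h : ∀ i, |f i| ≤ C) :
    |∑ i, f i| ≤ n * C := by
  refine (Finset.abs_sum_le_sum_abs _ _).trans ((Finset.sum_le_sum fun i _ => h i).trans ?_)
  simp

theorem abs_signed_sum_le {Z : Type*} {n : ℕ} {g : Z → ℝ} {C : ℝ} (hC : ∀ z, |g z| ≤ C)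
    (ε : Fin n → ℤˣ) (S : Fin n → Z) : |∑ i, ((ε i : ℤ) : ℝ) * g (S i)| ≤ n * C :=
  abs_sum_le_of_abs_le fun i => by rw [abs_intUnit_mul]; exact hC _

theorem measurable_signedSup {Z ι : Type*} [MeasurableSpace Z] [Countable ι] {n : ℕ}
    {g : ι → Z → ℝ} (hg : ∀ k, Measurable (g k)) (ε : Fin n → ℤˣ) :
    Measurable (signedSup g ε) :=
  Measurable.iSup fun k => Finset.measurable_sum _ fun i _ =>
    ((hg k).comp (measurable_pi_apply i)).const_mul _

/-- Exchange the two samples in the coordinates with negative sign. -/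
def signedSwap {Z : Type*} {n : ℕ} (ε : Fin n → ℤˣ) (p : (Fin n → Z) × (Fin n → Z)) :
    (Fin n → Z) × (Fin n → Z) :=
  (fun i => if ε i = 1 then p.1 i else p.2 i, fun i => if ε i = 1 then p.2 i else p.1 i)

/-- Regrouped as `n` independent pairs with law `D.prod D`, the map acts on each pair by the
identity or the swap. -/
theorem measurePreserving_signedSwap {Z : Type*} [MeasurableSpace Z] (D : Measure Z)
    [IsProbabilityMeasure D] {n : ℕ} (ε : Fin n → ℤˣ) :
    MeasurePreserving (signedSwap ε)
      ((Measure.pi fun _ : Fin n => D).prod (Measure.pi fun _ : Fin n => D))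
      ((Measure.pi fun _ : Fin n => D).prod (Measure.pi fun _ : Fin n => D)) := by
  have he := measurePreserving_arrowProdEquivProdArrow Z Z (Fin n) (fun _ => D) (fun _ => D)
  have hs : MeasurePreserving
      (fun (a : Fin n → Z × Z) i => (if ε i = 1 then id else Prod.swap) (a i))
      (Measure.pi fun _ => D.prod D) (Measure.pi fun _ => D.prod D) := by
    refine measurePreserving_pi _ _ (f := fun i => if ε i = 1 then id else Prod.swap) fun i => ?_
    split_ifs
    · exact MeasurePreserving.id _
    · exact Measure.measurePreserving_swap
  have h := (he.comp hs).comp he.symm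
  convert h using 1
  funext p
  refine Prod.ext (funext fun i => ?_) (funext fun i => ?_)
  · change (if ε i = 1 then p.1 i else p.2 i) =
      ((if ε i = 1 then id else Prod.swap : Z × Z → Z × Z) (p.1 i, p.2 i)).1
    split_ifs <;> rfl
  · change (if ε i = 1 then p.2 i else p.1 i) =
      ((if ε i = 1 then id else Prod.swap : Z × Z → Z × Z) (p.1 i, p.2 i)).2
    split_ifs <;> rfl

/-- **Symmetrization**: the expected uniform deviation is at most twice the empirical Rademacher
complexity. -/
theorem integral_iSup_deviation_le {Z ι : Type*} [MeasurableSpace Z] [Countable ι] [Nonempty ι]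
    (D : Measure Z) [IsProbabilityMeasure D] {n : ℕ} {g : ι → Z → ℝ}
    (hg : ∀ k, Measurable (g k)) {C : ℝ} (hC : ∀ k z, |g k z| ≤ C) {R : ℝ}
    (hR : ∀ S : Fin n → Z, ∑ ε : Fin n → ℤˣ, signedSup g ε S ≤ 2 ^ n * R) :
    ∫ S, ⨆ k, (n * ∫ z, g k z ∂D - ∑ i, g k (S i)) ∂Measure.pi (fun _ : Fin n => D) ≤ 2 * R := by
  set μ := Measure.pi fun _ : Fin n => D with hμ
  set Ψ : (Fin n → ℤˣ) → (Fin n → Z) × (Fin n → Z) → ℝ := fun ε p =>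
    ⨆ k, ∑ i, ((ε i : ℤ) : ℝ) * (g k (p.2 i) - g k (p.1 i)) with hΨ
  have hdiff : ∀ k z z', |g k z - g k z'| ≤ C + C := fun k z z' =>
    (abs_sub _ _).trans (add_le_add (hC k z) (hC k z'))
  have hterm : ∀ (ε : Fin n → ℤˣ) (p : (Fin n → Z) × (Fin n → Z)) (k : ι),
      |∑ i, ((ε i : ℤ) : ℝ) * (g k (p.2 i) - g k (p.1 i))| ≤ n * (C + C) :=
    fun ε p k => abs_sum_le_of_abs_le fun i => by rw [abs_intUnit_mul]; exact hdiff _ _ _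
  have hΨm : ∀ ε, Measurable (Ψ ε) := fun ε => Measurable.iSup fun k =>
    Finset.measurable_sum _ fun i _ => (((hg k).comp ((measurable_pi_apply i).comp
      measurable_snd)).sub ((hg k).comp ((measurable_pi_apply i).comp measurable_fst))).const_mul _
  have hΨC : ∀ ε p, |Ψ ε p| ≤ n * (C + C) := fun ε p => abs_ciSup_le (hterm ε p)
  have hΨi : ∀ ε, Integrable (Ψ ε) (μ.prod μ) := fun ε =>
    integrable_of_measurable_of_abs_le (hΨm ε) (hΨC ε)
  have hsm : ∀ ε, Measurable (signedSup g ε : (Fin n → Z) → ℝ) := measurable_signedSup hg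
  have hsi : ∀ ε, Integrable (signedSup g ε : (Fin n → Z) → ℝ) μ := fun ε =>
    integrable_of_measurable_of_abs_le (hsm ε) (C := n * C) fun S =>
      abs_ciSup_le fun k => abs_signed_sum_le (hC k) ε S
  have hgi : ∀ k i, Integrable (fun S : Fin n → Z => g k (S i)) μ := fun k i =>
    integrable_of_measurable_of_abs_le ((hg k).comp (measurable_pi_apply i)) fun S => hC k _
  have hgeval : ∀ k i, ∫ S : Fin n → Z, g k (S i) ∂μ = ∫ z, g k z ∂D := fun k i => by
    have he := measurePreserving_eval (fun _ : Fin n => D) i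
    rw [← he.map_eq, integral_map he.measurable.aemeasurable (hg k).aestronglyMeasurable]
  -- Ghost sample: the true mean is an average over an independent copy `S'`, and a supremum of
  -- averages is at most the average of suprema.
  have hghost : ∫ S, ⨆ k, (n * ∫ z, g k z ∂D - ∑ i, g k (S i)) ∂μ ≤ ∫ p, Ψ 1 p ∂(μ.prod μ) := by
    rw [integral_prod _ (hΨi 1)]
    have hmeas : Measurable fun S : Fin n → Z => ⨆ k, (n * ∫ z, g k z ∂D - ∑ i, g k (S i)) :=
      Measurable.iSup fun k => (Finset.measurable_sum _ fun i _ =>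
        (hg k).comp (measurable_pi_apply i)).const_sub _
    have hmeanC : ∀ k, |∫ z, g k z ∂D| ≤ C := fun k =>
      abs_integral_le_of_abs_le D (hC k)
    refine integral_mono (integrable_of_measurable_of_abs_le hmeas (C := n * C + n * C) fun S =>
      abs_ciSup_le fun k => (abs_sub _ _).trans (add_le_add ?_ ?_)) (hΨi 1).integral_prod_left
      fun S => ciSup_le fun k => ?_
    · rw [abs_mul, Nat.abs_cast]
      exact mul_le_mul_of_nonneg_left (hmeanC k) (Nat.cast_nonneg n)
    · exact abs_sum_le_of_abs_le fun i => hC k _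
    · have : (n * ∫ z, g k z ∂D - ∑ i, g k (S i)) =
          ∫ S', ∑ i, ((((1 : Fin n → ℤˣ) i : ℤ) : ℝ) * (g k (S' i) - g k (S i))) ∂μ := by
        simp only [Pi.one_apply, Units.val_one, Int.cast_one, one_mul, Finset.sum_sub_distrib]
        rw [integral_sub (integrable_finsetSum _ fun i _ => hgi k i) (integrable_const _),
          integral_finsetSum _ fun i _ => hgi k i]
        simp [hgeval]
      rw [this]
      refine integral_mono (integrable_of_measurable_of_abs_le ?_ fun S' => hterm 1 (S, S') k)
        (integrable_of_measurable_of_abs_le ((hΨm 1).comp measurable_prodMk_left)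
          fun S' => hΨC 1 (S, S')) fun S' =>
        le_ciSup (f := fun k => ∑ i, ((((1 : Fin n → ℤˣ) i : ℤ) : ℝ) * (g k (S' i) - g k (S i))))
          (bddAbove_range_of_abs_le (hterm 1 (S, S'))) k
      exact Finset.measurable_sum _ fun i _ =>
        (((hg k).comp (measurable_pi_apply i)).sub_const _).const_mul _
  have hswap : ∀ ε, ∫ p, Ψ 1 p ∂(μ.prod μ) = ∫ p, Ψ ε p ∂(μ.prod μ) := fun ε => by
    have hs := measurePreserving_signedSwap D ε
    conv_lhs => rw [hμ, ← hs.map_eq]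
    rw [integral_map hs.measurable.aemeasurable (hΨm 1).aestronglyMeasurable]
    congr 1 with p
    refine congrArg iSup (funext fun k => Finset.sum_congr rfl fun i _ => ?_)
    rcases Int.units_eq_one_or (ε i) with h | h <;> simp [signedSwap, h]
  -- The two samples separate by subadditivity of the supremum. Summed over all `ε`, the terms for
  -- `ε` and `-ε` agree, whence the factor 2.
  have hsplit : ∀ ε, ∫ p, Ψ ε p ∂(μ.prod μ) ≤
      ∫ S, signedSup g ε S ∂μ + ∫ S, signedSup g (-ε) S ∂μ := fun ε => by
    have h2 : Integrable (fun p : (Fin n → Z) × (Fin n → Z) => signedSup g ε p.2) (μ.prod μ) :=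
      (hsi ε).comp_snd μ
    have h1 : Integrable (fun p : (Fin n → Z) × (Fin n → Z) => signedSup g (-ε) p.1) (μ.prod μ) :=
      (hsi (-ε)).comp_fst μ
    have hle : ∫ p, Ψ ε p ∂(μ.prod μ) ≤
        ∫ p, (signedSup g ε p.2 + signedSup g (-ε) p.1) ∂(μ.prod μ) := by
      refine integral_mono (hΨi ε) (h2.add h1) fun p => ciSup_le fun k => ?_
      have e2 := le_ciSup (bddAbove_range_of_abs_le fun k => abs_signed_sum_le (hC k) ε p.2) k
      have e1 := le_ciSup (bddAbove_range_of_abs_le fun k => abs_signed_sum_le (hC k) (-ε) p.1) k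
      refine le_trans (le_of_eq ?_) (add_le_add e2 e1)
      rw [← Finset.sum_add_distrib]
      refine Finset.sum_congr rfl fun i _ => ?_
      simp only [Pi.neg_apply, Units.val_neg, Int.cast_neg]
      ring
    refine hle.trans (le_of_eq ?_)
    rw [integral_add h2 h1]
    congr 1
    · simpa using integral_fun_snd (μ := μ) (ν := μ) (signedSup g ε)
    · simpa using integral_fun_fst (μ := μ) (ν := μ) (signedSup g (-ε))
  have hcard : (Fintype.card (Fin n → ℤˣ) : ℝ) = 2 ^ n := by simp
  have hsum : (2 : ℝ) ^ n * ∫ p, Ψ 1 p ∂(μ.prod μ) ≤ 2 ^ n * (2 * R) := by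
    calc (2 : ℝ) ^ n * ∫ p, Ψ 1 p ∂(μ.prod μ) = ∑ ε : Fin n → ℤˣ, ∫ p, Ψ ε p ∂(μ.prod μ) := by
          rw [← hcard, ← nsmul_eq_mul, ← Finset.card_univ, ← Finset.sum_const]
          exact Finset.sum_congr rfl fun ε _ => hswap ε
      _ ≤ ∑ ε : Fin n → ℤˣ, (∫ S, signedSup g ε S ∂μ + ∫ S, signedSup g (-ε) S ∂μ) :=
          Finset.sum_le_sum fun ε _ => hsplit ε
      _ = 2 * ∫ S, ∑ ε : Fin n → ℤˣ, signedSup g ε S ∂μ := by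
          rw [Finset.sum_add_distrib, integral_finsetSum _ fun ε _ => hsi ε, two_mul]
          congr 1
          exact Equiv.sum_comp (Equiv.neg (Fin n → ℤˣ)) fun ε => ∫ S, signedSup g ε S ∂μ
      _ ≤ 2 * (2 ^ n * R) := by
          have : ∫ S, ∑ ε : Fin n → ℤˣ, signedSup g ε S ∂μ ≤ ∫ _, 2 ^ n * R ∂μ :=
            integral_mono (integrable_finsetSum _ fun ε _ => hsi ε) (integrable_const _) hR
          rw [integral_const] at this
          simpa using this
      _ = 2 ^ n * (2 * R) := by ring
  exact hghost.trans (le_of_mul_le_mul_left hsum (by positivity))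

/-! ### Uniform deviation with high probability -/

/-- Uniform deviation bound for a countable class of `[0, B]`-valued functions in terms of its
empirical Rademacher complexity. -/
theorem exists_measurableSet_uniform_deviation_le {Z ι : Type*} [MeasurableSpace Z] [Countable ι]
    [Nonempty ι] (D : Measure Z) [IsProbabilityMeasure D] {n : ℕ} (hn : 1 ≤ n) {g : ι → Z → ℝ}
    (hg : ∀ k, Measurable (g k)) {B : ℝ} (hB : 0 < B) (h0 : ∀ k z, 0 ≤ g k z)
    (hgB : ∀ k z, g k z ≤ B) {R : ℝ}
    (hR : ∀ S : Fin n → Z, ∑ ε : Fin n → ℤˣ, signedSup g ε S ≤ 2 ^ n * R)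
    {δ : ℝ} (hδ : 0 < δ) :
    ∃ E : Set (Fin n → Z), MeasurableSet E ∧
      ENNReal.ofReal (1 - δ) ≤ Measure.pi (fun _ : Fin n => D) E ∧
      ∀ S ∈ E, ∀ k, n * ∫ z, g k z ∂D ≤
        ∑ i, g k (S i) + 2 * R + n * B * √(Real.log (1 / δ) / (2 * n)) := by
  -- For `1 ≤ δ` the empty event already has the required probability.
  rcases le_or_gt 1 δ with h1 | h1
  · exact ⟨∅, MeasurableSet.empty, by simp [h1], by simp⟩
  have hn' : (0 : ℝ) < n := by exact_mod_cast hn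
  set μ := Measure.pi fun _ : Fin n => D
  set G : (Fin n → Z) → ℝ := fun S => ⨆ k, (n * ∫ z, g k z ∂D - ∑ i, g k (S i)) with hG
  have hC : ∀ k z, |g k z| ≤ B := fun k z => abs_le.2 ⟨by linarith [h0 k z], hgB k z⟩
  have hGm : Measurable G := Measurable.iSup fun k => (Finset.measurable_sum _ fun i _ =>
    (hg k).comp (measurable_pi_apply i)).const_sub _
  have hterm : ∀ (S : Fin n → Z) (k : ι),
      |n * ∫ z, g k z ∂D - ∑ i, g k (S i)| ≤ n * B + n * B := fun S k => by
    refine (abs_sub _ _).trans (add_le_add ?_ (abs_sum_le_of_abs_le fun i => hC k _))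
    rw [abs_mul, Nat.abs_cast]
    exact mul_le_mul_of_nonneg_left (abs_integral_le_of_abs_le D (hC k)) (Nat.cast_nonneg n)
  have hGle : ∀ S S' : Fin n → Z, ∀ i, (∀ j ≠ i, S j = S' j) → G S ≤ G S' + B :=
      fun S S' i h => ciSup_le fun k => by
    have h1 := le_ciSup (bddAbove_range_of_abs_le (hterm S')) k
    have h2 : ∑ j, g k (S' j) - ∑ j, g k (S j) ≤ B := by
      rw [← Finset.sum_sub_distrib, Finset.sum_eq_single i (fun j _ hj => by rw [h j hj, sub_self])
        (fun h => absurd (Finset.mem_univ i) h)]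
      linarith [hgB k (S' i), h0 k (S i)]
    change _ ≤ (⨆ k, _) + B
    linarith
  have hGd : ∀ S i z, |G (Function.update S i z) - G S| ≤ B := fun S i z => by
    have e1 := hGle (Function.update S i z) S i fun j hj => Function.update_of_ne hj _ _
    have e2 := hGle S (Function.update S i z) i fun j hj => (Function.update_of_ne hj _ _).symm
    exact abs_le.2 ⟨by linarith, by linarith⟩
  -- Chosen so that the McDiarmid tail at `τ` equals `δ` exactly.
  set τ : ℝ := n * B * √(Real.log (1 / δ) / (2 * n)) with hτ
  have hlog : 0 ≤ Real.log (1 / δ) := Real.log_nonneg (by rw [le_div_iff₀ hδ]; linarith)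
  have hτ0 : 0 ≤ τ := by positivity
  have htail := measure_le_sub_integral_le_of_bounded_differences D hn hB hGm
    (fun S => abs_ciSup_le (hterm S)) hGd hτ0
  have hexp : Real.exp (-2 * τ ^ 2 / (n * B ^ 2)) = δ := by
    have : -2 * τ ^ 2 / (n * B ^ 2) = Real.log δ := by
      rw [hτ, mul_pow, Real.sq_sqrt (by positivity), one_div, Real.log_inv]
      field_simp
    rw [this, Real.exp_log hδ]
  rw [hexp] at htail
  set T : Set (Fin n → Z) := {S | τ ≤ G S - ∫ S', G S' ∂μ} with hT
  have hTm : MeasurableSet T := measurableSet_le measurable_const (hGm.sub_const _)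
  refine ⟨Tᶜ, hTm.compl, ?_, fun S hS k => ?_⟩
  · rw [← ofReal_measureReal]
    refine ENNReal.ofReal_le_ofReal ?_
    rw [probReal_compl_eq_one_sub hTm]
    linarith
  · have h1 : G S - ∫ S', G S' ∂μ < τ := not_le.1 hS
    have h2 := le_ciSup (bddAbove_range_of_abs_le (hterm S)) k
    have h3 : ∫ S', G S' ∂μ ≤ 2 * R := integral_iSup_deviation_le D hg hC hR
    have h4 : n * ∫ z, g k z ∂D - ∑ i, g k (S i) ≤ G S := h2
    linarith

/-! ### Contraction of Rademacher sums -/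

theorem sum_signs_fin_succ {n : ℕ} (F : (Fin (n + 1) → ℤˣ) → ℝ) :
    ∑ ε, F ε = ∑ ε : Fin n → ℤˣ, (F (Fin.cons 1 ε) + F (Fin.cons (-1) ε)) := by
  rw [← Equiv.sum_comp (Fin.consEquiv fun _ : Fin (n + 1) => ℤˣ) F, Fintype.sum_prod_type_right]
  refine Finset.sum_congr rfl fun ε _ => ?_
  have : (Finset.univ : Finset ℤˣ) = {1, -1} := rfl
  rw [this, Finset.sum_pair (by decide)]
  rfl

/-- Combines `(x + y) ^ 2 ≤ 2 * (x ^ 2 + y ^ 2)` with the parallelogram law. It is the inductive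
step that keeps the Rademacher bound at order `√n`. -/
theorem sqrt_norm_add_add_sqrt_norm_sub_le {E : Type*} [NormedAddCommGroup E]
    [InnerProductSpace ℝ E] (v a : E) {σ N : ℝ} (ha : ‖a‖ ^ 2 ≤ σ) (hN : 0 ≤ N) :
    √(‖v + a‖ ^ 2 + N) + √(‖v - a‖ ^ 2 + N) ≤ 2 * √(‖v‖ ^ 2 + (σ + N)) := by
  have h := parallelogram_law_with_norm ℝ v a
  have hx := Real.sq_sqrt (show 0 ≤ ‖v + a‖ ^ 2 + N by positivity)
  have hy := Real.sq_sqrt (show 0 ≤ ‖v - a‖ ^ 2 + N by positivity)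
  have hσ : 0 ≤ σ := (sq_nonneg _).trans ha
  have hz := Real.sq_sqrt (show 0 ≤ ‖v‖ ^ 2 + (σ + N) by positivity)
  refine le_of_sq_le_sq ?_ (by positivity)
  nlinarith [sq_nonneg (√(‖v + a‖ ^ 2 + N) - √(‖v - a‖ ^ 2 + N))]

/-- **Contraction** for Rademacher sums over a ball of a Hilbert space: the increments of each
summand are dominated by a convex combination of linear increments. -/
theorem sum_signs_iSup_le {E ι m : Type*} [NormedAddCommGroup E] [InnerProductSpace ℝ E]
    [Nonempty ι] [Fintype m] {W : ι → E} {Λ : ℝ} (hΛ : 0 ≤ Λ) (hW : ∀ k, ‖W k‖ ≤ Λ) {σ C : ℝ}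
    (hσ : 0 ≤ σ) :
    ∀ (n : ℕ) (h : Fin n → ι → ℝ) (w : Fin n → m → ℝ) (a : Fin n → m → E)
      (_ : ∀ i j, 0 ≤ w i j) (_ : ∀ i, ∑ j, w i j = 1) (_ : ∀ i j, ‖a i j‖ ^ 2 ≤ σ)
      (_ : ∀ i k l, h i k - h i l ≤ ∑ j, w i j * |inner ℝ (W k) (a i j) - inner ℝ (W l) (a i j)|)
      (_ : ∀ i k, |h i k| ≤ C) (v : E),
      ∑ ε : Fin n → ℤˣ, ⨆ k, (inner ℝ (W k) v + ∑ i, ((ε i : ℤ) : ℝ) * h i k) ≤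
        2 ^ n * (Λ * √(‖v‖ ^ 2 + n * σ)) := by
  have hinner : ∀ k v, |inner ℝ (W k) v| ≤ Λ * ‖v‖ := fun k v =>
    (abs_real_inner_le_norm _ _).trans (mul_le_mul_of_nonneg_right (hW k) (norm_nonneg v))
  -- The vector `v` accumulates the linear forms that have replaced summands already treated, so the
  -- induction must quantify over it. `C` serves only to keep the suprema finite.
  intro n
  induction n with
  | zero =>
    intro h w a _ _ _ _ _ v
    simpa using ciSup_le fun k => (le_abs_self _).trans (hinner k v)
  | succ n ih =>
    intro h w a hw0 hw1 ha hlip hC v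
    have hbdd : ∀ (ε : Fin n → ℤˣ) (v : E), BddAbove (Set.range fun k =>
        inner ℝ (W k) v + ∑ i : Fin n, ((ε i : ℤ) : ℝ) * h i.succ k) := fun ε v =>
      bddAbove_range_of_abs_le (C := Λ * ‖v‖ + n * C) fun k => (abs_add_le _ _).trans
        (add_le_add (hinner k v) (abs_sum_le_of_abs_le fun i => by
          rw [abs_intUnit_mul]; exact hC _ _))
    set Q : (Fin n → ℤˣ) → E → ℝ := fun ε v =>
      ⨆ k, (inner ℝ (W k) v + ∑ i : Fin n, ((ε i : ℤ) : ℝ) * h i.succ k) with hQ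
    have hQle : ∀ ε v k, inner ℝ (W k) v + ∑ i : Fin n, ((ε i : ℤ) : ℝ) * h i.succ k ≤ Q ε v :=
      fun ε v k => le_ciSup (hbdd ε v) k
    have hQsum : ∀ v, ∑ ε, Q ε v ≤ 2 ^ n * (Λ * √(‖v‖ ^ 2 + n * σ)) := fun v =>
      ih (fun i => h i.succ) (fun i => w i.succ) (fun i => a i.succ) (fun i => hw0 _)
        (fun i => hw1 _) (fun i => ha _) (fun i => hlip _) (fun i => hC _) v
    have hstep : ∀ ε : Fin n → ℤˣ,
        (⨆ k, (inner ℝ (W k) v + ∑ i, (((Fin.cons 1 ε : Fin (n + 1) → ℤˣ) i : ℤ) : ℝ) * h i k)) +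
          (⨆ k, (inner ℝ (W k) v +
            ∑ i, (((Fin.cons (-1) ε : Fin (n + 1) → ℤˣ) i : ℤ) : ℝ) * h i k)) ≤
        ∑ j, w 0 j * (Q ε (v + a 0 j) + Q ε (v - a 0 j)) := fun ε => by
      -- Opposite first signs give two independent suprema; for a fixed pair of indices the first
      -- summand enters only through `h 0 k - h 0 l`, to which `hlip` applies.
      have hkl : ∀ k l,
          (inner ℝ (W k) v + ∑ i, (((Fin.cons 1 ε : Fin (n + 1) → ℤˣ) i : ℤ) : ℝ) * h i k) +
            (inner ℝ (W l) v + ∑ i, (((Fin.cons (-1) ε : Fin (n + 1) → ℤˣ) i : ℤ) : ℝ) * h i l) ≤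
          ∑ j, w 0 j * (Q ε (v + a 0 j) + Q ε (v - a 0 j)) := fun k l => by
        simp only [Fin.sum_univ_succ, Fin.cons_zero, Fin.cons_succ, Units.val_one, Int.cast_one,
          one_mul, Units.val_neg, Int.cast_neg, neg_mul]
        set A : ι → ℝ := fun k =>
          inner ℝ (W k) v + ∑ i : Fin n, ((ε i : ℤ) : ℝ) * h i.succ k with hA
        have h1 : A k + A l + (h 0 k - h 0 l) ≤
            ∑ j, w 0 j * (Q ε (v + a 0 j) + Q ε (v - a 0 j)) := by
          calc A k + A l + (h 0 k - h 0 l)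
              ≤ A k + A l + ∑ j, w 0 j * |inner ℝ (W k) (a 0 j) - inner ℝ (W l) (a 0 j)| :=
                add_le_add_right (hlip 0 k l) _
            _ = ∑ j, w 0 j * (A k + A l + |inner ℝ (W k) (a 0 j) - inner ℝ (W l) (a 0 j)|) := by
                simp only [mul_add, Finset.sum_add_distrib, ← Finset.sum_mul, hw1 0]
                ring
            _ ≤ _ := by
                refine Finset.sum_le_sum fun j _ => mul_le_mul_of_nonneg_left ?_ (hw0 0 j)
                -- The sign inside the absolute value decides which of `k`, `l` is paired with `v +
                -- a 0 j` and which with `v - a 0 j`; the bound is symmetric in the two.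
                have e1 := hQle ε (v + a 0 j) k
                have e2 := hQle ε (v - a 0 j) l
                have e3 := hQle ε (v + a 0 j) l
                have e4 := hQle ε (v - a 0 j) k
                rw [inner_add_right] at e1 e3
                rw [inner_sub_right] at e2 e4
                simp only [hA]
                rcases abs_cases (inner ℝ (W k) (a 0 j) - inner ℝ (W l) (a 0 j)) with
                  ⟨e, _⟩ | ⟨e, _⟩ <;> rw [e] <;> linarith
        simp only [hA] at h1
        linarith
      refine le_sub_iff_add_le.1 (ciSup_le fun k => ?_)
      refine le_sub_comm.1 (ciSup_le fun l => ?_)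
      linarith [hkl k l]
    rw [sum_signs_fin_succ]
    calc _ ≤ ∑ ε, ∑ j, w 0 j * (Q ε (v + a 0 j) + Q ε (v - a 0 j)) :=
          Finset.sum_le_sum fun ε _ => hstep ε
      _ = ∑ j, w 0 j * (∑ ε, Q ε (v + a 0 j) + ∑ ε, Q ε (v - a 0 j)) := by
          rw [Finset.sum_comm]
          simp only [Finset.mul_sum, ← Finset.sum_add_distrib]
      _ ≤ ∑ j, w 0 j * (2 ^ (n + 1) * (Λ * √(‖v‖ ^ 2 + (n + 1 : ℕ) * σ))) := by
          refine Finset.sum_le_sum fun j _ => mul_le_mul_of_nonneg_left ?_ (hw0 0 j)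
          have e := sqrt_norm_add_add_sqrt_norm_sub_le v (a 0 j) (N := n * σ) (ha 0 j)
            (by positivity)
          have e' := mul_le_mul_of_nonneg_left e (show 0 ≤ 2 ^ n * Λ by positivity)
          rw [show ((n + 1 : ℕ) : ℝ) * σ = σ + n * σ by push_cast; ring, pow_succ]
          linarith [hQsum (v + a 0 j), hQsum (v - a 0 j)]
      _ = 2 ^ (n + 1) * (Λ * √(‖v‖ ^ 2 + (n + 1 : ℕ) * σ)) := by
          rw [← Finset.sum_mul, hw1 0, one_mul]

/-! ### The ranking loss as an average over label pairs -/

theorem surrogateRankingLoss_eq_sum_ite {c : ℕ} (ℓ : ℝ → ℝ) (s : Fin c → ℝ) (y : Label c) :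
    surrogateRankingLoss ℓ s y = ∑ m : Fin c × Fin c,
      (if m ∈ relevant y ×ˢ irrelevant y then
        1 / (((relevant y).card : ℝ) * ((irrelevant y).card : ℝ)) else 0) * ℓ (s m.1 - s m.2) := by
  simp only [ite_mul, zero_mul, Finset.sum_ite_mem, Finset.univ_inter]
  rw [surrogateRankingLoss, Finset.mul_sum, Finset.sum_product]
  simp only [Finset.mul_sum]

/-- The surrogate ranking loss is an average of `ℓ` over pairs of labels, or vanishes. -/
theorem exists_weights_surrogateRankingLoss {c : ℕ} (hc : 1 ≤ c) (y : Label c) :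
    ∃ w : Fin c × Fin c → ℝ, (∀ m, 0 ≤ w m) ∧ ∑ m, w m = 1 ∧
      ((∀ ℓ s, surrogateRankingLoss ℓ s y = ∑ m, w m * ℓ (s m.1 - s m.2)) ∨
        ∀ ℓ s, surrogateRankingLoss ℓ s y = 0) := by
  by_cases h : (relevant y).card * (irrelevant y).card = 0
  -- Dummy weights: the loss vanishes here, but contraction still asks for total weight 1.
  · refine ⟨fun m => if m = (⟨0, hc⟩, ⟨0, hc⟩) then 1 else 0, fun m => by positivity, by simp,
      Or.inr fun ℓ s => ?_⟩
    have : ((relevant y).card : ℝ) * ((irrelevant y).card : ℝ) = 0 := by exact_mod_cast h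
    rw [surrogateRankingLoss, this, div_zero, zero_mul]
  · refine ⟨fun m => if m ∈ relevant y ×ˢ irrelevant y then
        1 / (((relevant y).card : ℝ) * ((irrelevant y).card : ℝ)) else 0, fun m => ?_, ?_,
      Or.inl fun ℓ s => surrogateRankingLoss_eq_sum_ite ℓ s y⟩
    · positivity
    · have : ((relevant y).card : ℝ) * ((irrelevant y).card : ℝ) ≠ 0 := by exact_mod_cast h
      rw [Finset.sum_ite_mem, Finset.univ_inter, Finset.sum_const, Finset.card_product,
        nsmul_eq_mul, Nat.cast_mul, mul_one_div_cancel this]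

theorem surrogateRankingLoss_nonneg {c : ℕ} {ℓ : ℝ → ℝ} (hℓ : ∀ u, 0 ≤ ℓ u) (s : Fin c → ℝ)
    (y : Label c) : 0 ≤ surrogateRankingLoss ℓ s y :=
  mul_nonneg (by positivity) (Finset.sum_nonneg fun _ _ => Finset.sum_nonneg fun _ _ => hℓ _)

theorem surrogateRankingLoss_mono {c : ℕ} {ℓ ℓ' : ℝ → ℝ} (h : ∀ u, ℓ u ≤ ℓ' u) (s : Fin c → ℝ)
    (y : Label c) : surrogateRankingLoss ℓ s y ≤ surrogateRankingLoss ℓ' s y :=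
  mul_le_mul_of_nonneg_left (Finset.sum_le_sum fun _ _ => Finset.sum_le_sum fun _ _ => h _)
    (by positivity)

theorem rankingLoss01_eq_surrogateRankingLoss {c : ℕ} (s : Fin c → ℝ) (y : Label c) :
    rankingLoss01 s y = surrogateRankingLoss (fun u => if u ≤ 0 then 1 else 0) s y := by
  simp only [rankingLoss01, surrogateRankingLoss, sub_nonpos]

theorem surrogateRankingLoss_le {c : ℕ} (hc : 1 ≤ c) {ℓ : ℝ → ℝ} {s : Fin c → ℝ} {B : ℝ}
    (hB0 : 0 ≤ B) (hB : ∀ p q, ℓ (s p - s q) ≤ B) (y : Label c) :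
    surrogateRankingLoss ℓ s y ≤ B := by
  obtain ⟨w, hw0, hw1, h | h⟩ := exists_weights_surrogateRankingLoss hc y
  · rw [h]
    calc ∑ m, w m * ℓ (s m.1 - s m.2) ≤ ∑ m, w m * B :=
          Finset.sum_le_sum fun m _ => mul_le_mul_of_nonneg_left (hB _ _) (hw0 m)
      _ = B := by rw [← Finset.sum_mul, hw1, one_mul]
  · rw [h]; exact hB0

/-- The weights depend on `y` alone, so one choice per data point serves all hypotheses at once, as
`sum_signs_iSup_le` requires. -/
theorem exists_weights_surrogateRankingLoss_sub_le {c : ℕ} (hc : 1 ≤ c) (y : Label c) :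
    ∃ w : Fin c × Fin c → ℝ, (∀ m, 0 ≤ w m) ∧ ∑ m, w m = 1 ∧
      ∀ (ℓ : ℝ → ℝ) (ρ : ℝ≥0) (_ : LipschitzWith ρ ℓ) (s s' : Fin c → ℝ),
        surrogateRankingLoss ℓ s y - surrogateRankingLoss ℓ s' y ≤
          ∑ m, w m * (ρ * |(s m.1 - s m.2) - (s' m.1 - s' m.2)|) := by
  obtain ⟨w, hw0, hw1, h⟩ := exists_weights_surrogateRankingLoss hc y
  refine ⟨w, hw0, hw1, fun ℓ ρ hρ s s' => ?_⟩
  rcases h with h | h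
  · rw [h, h, ← Finset.sum_sub_distrib]
    refine Finset.sum_le_sum fun m _ => ?_
    rw [← mul_sub]
    refine mul_le_mul_of_nonneg_left ((le_abs_self _).trans ?_) (hw0 m)
    exact hρ.dist_le_mul (s m.1 - s m.2) (s' m.1 - s' m.2)
  · rw [h, h, sub_self]
    exact Finset.sum_nonneg fun m _ => mul_nonneg (hw0 m) (by positivity)

theorem continuous_surrogateRankingLoss {c : ℕ} {ℓ : ℝ → ℝ} (hℓ : Continuous ℓ) (y : Label c) :
    Continuous fun s => surrogateRankingLoss ℓ s y := by
  unfold surrogateRankingLoss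
  fun_prop

/-- Lets joint measurability in `(x, y)` be checked for each of the finitely many label vectors. -/
instance measurableSingletonClass_intUnits : MeasurableSingletonClass ℤˣ :=
  ⟨fun a => ⟨{(a : ℤ)}, measurableSet_singleton _, by ext b; simp [Units.ext_iff]⟩⟩

theorem measurable_surrogateRankingLoss {𝒳 : Type*} [MeasurableSpace 𝒳] {c : ℕ} {ℓ : ℝ → ℝ}
    (hℓ : Continuous ℓ) {f : 𝒳 → Fin c → ℝ} (hf : Measurable f) :
    Measurable fun z : 𝒳 × Label c => surrogateRankingLoss ℓ (f z.1) z.2 :=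
  measurable_from_prod_countable_left fun y =>
    (continuous_surrogateRankingLoss hℓ y).measurable.comp hf

/-! ### The kernel class as a ball in a direct sum of Hilbert spaces -/

section KernelScores

variable {𝒳 H : Type*} [NormedAddCommGroup H] [InnerProductSpace ℝ H] {c : ℕ}

/-- The score function of the weights `W`. -/
noncomputable def kernelScore (φ : 𝒳 → H) (W : PiLp 2 fun _ : Fin c => H) : 𝒳 → Fin c → ℝ :=
  fun x j => inner ℝ (W j) (φ x)

theorem kernelScore_mem_kernelClass (φ : 𝒳 → H) {W : PiLp 2 fun _ : Fin c => H} {Λ : ℝ}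
    (hW : ‖W‖ ≤ Λ) : kernelScore φ W ∈ kernelClass c φ Λ :=
  ⟨W, by rwa [← PiLp.norm_eq_of_L2], rfl⟩

theorem exists_eq_kernelScore_of_mem_kernelClass {φ : 𝒳 → H} {Λ : ℝ} {f : 𝒳 → Fin c → ℝ}
    (hf : f ∈ kernelClass c φ Λ) :
    ∃ W : PiLp 2 fun _ : Fin c => H, ‖W‖ ≤ Λ ∧ f = kernelScore φ W := by
  obtain ⟨W, hW, rfl⟩ := hf
  exact ⟨WithLp.toLp 2 W, by rwa [PiLp.norm_eq_of_L2], rfl⟩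

/-- The vector whose inner product with the weights is the difference of the scores `p`, `q`. -/
noncomputable def scoreDiffVec (p q : Fin c) (x : H) : PiLp 2 fun _ : Fin c => H :=
  WithLp.toLp 2 (Pi.single p x - Pi.single q x)

theorem inner_scoreDiffVec (W : PiLp 2 fun _ : Fin c => H) (p q : Fin c) (x : H) :
    inner ℝ W (scoreDiffVec p q x) = inner ℝ (W p) x - inner ℝ (W q) x := by
  have h : ∀ p : Fin c, ∑ j, inner ℝ (W j) ((Pi.single p x : Fin c → H) j) = inner ℝ (W p) x :=
    fun p => by
      rw [Finset.sum_eq_single p (fun j _ hj => by rw [Pi.single_eq_of_ne hj, inner_zero_right])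
        (fun h => absurd (Finset.mem_univ p) h), Pi.single_eq_same]
  simp only [PiLp.inner_apply, scoreDiffVec, Pi.sub_apply, inner_sub_right,
    Finset.sum_sub_distrib, h]

/-- For `p ≠ q` the two components are orthogonal, which gives 2 in place of the 4 of the triangle
inequality; this is the source of `√2` in the final bound. -/
theorem norm_scoreDiffVec_sq_le (p q : Fin c) (x : H) :
    ‖scoreDiffVec p q x‖ ^ 2 ≤ 2 * ‖x‖ ^ 2 := by
  rw [← real_inner_self_eq_norm_sq, inner_scoreDiffVec]
  rcases eq_or_ne p q with rfl | h
  · rw [sub_self]; positivity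
  · simp only [scoreDiffVec, Pi.sub_apply, Pi.single_eq_same, Pi.single_eq_of_ne h,
      Pi.single_eq_of_ne h.symm, sub_zero, zero_sub, inner_neg_left, real_inner_self_eq_norm_sq]
    linarith

/-- The empirical Rademacher complexity of the surrogate ranking losses of a kernel class. -/
theorem sum_signedSup_surrogateRankingLoss_le {ι : Type*} [Nonempty ι] (hc : 1 ≤ c) {φ : 𝒳 → H}
    {r : ℝ} (hφ : ∀ x, ‖φ x‖ ^ 2 ≤ r ^ 2) {W : ι → PiLp 2 fun _ : Fin c => H} {Λ : ℝ}
    (hΛ : 0 ≤ Λ) (hW : ∀ k, ‖W k‖ ≤ Λ) {ℓ : ℝ → ℝ} {ρ : ℝ≥0} (hρ : LipschitzWith ρ ℓ) {C : ℝ}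
    (hC : ∀ k (z : 𝒳 × Label c), |surrogateRankingLoss ℓ (kernelScore φ (W k) z.1) z.2| ≤ C)
    {n : ℕ} (S : Fin n → 𝒳 × Label c) :
    ∑ ε : Fin n → ℤˣ, signedSup
        (fun k (z : 𝒳 × Label c) => surrogateRankingLoss ℓ (kernelScore φ (W k) z.1) z.2) ε S ≤
      2 ^ n * (Λ * √(n * (2 * (ρ * r) ^ 2))) := by
  choose w hw0 hw1 hw using fun i => exists_weights_surrogateRankingLoss_sub_le hc (S i).2
  have h := sum_signs_iSup_le hΛ hW (σ := 2 * (ρ * r) ^ 2) (C := C) (by positivity) n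
    (fun i k => surrogateRankingLoss ℓ (kernelScore φ (W k) (S i).1) (S i).2) w
    (fun i m => (ρ : ℝ) • scoreDiffVec m.1 m.2 (φ (S i).1)) hw0 hw1 (fun i m => ?_)
    (fun i k l => ?_) (fun i k => hC k (S i)) 0
  · simpa [signedSup] using h
  · rw [norm_smul, mul_pow, Real.norm_eq_abs, sq_abs]
    have := norm_scoreDiffVec_sq_le m.1 m.2 (φ (S i).1)
    have h2 := mul_le_mul_of_nonneg_left (this.trans (mul_le_mul_of_nonneg_left (hφ (S i).1)
      zero_le_two)) (sq_nonneg (ρ : ℝ))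
    exact h2.trans (le_of_eq (by ring))
  · refine (hw i ℓ ρ hρ _ _).trans (le_of_eq (Finset.sum_congr rfl fun m _ => ?_))
    rw [inner_smul_right, inner_smul_right, ← mul_sub, abs_mul, abs_of_nonneg ρ.coe_nonneg,
      inner_scoreDiffVec, inner_scoreDiffVec]
    rfl

end KernelScores

/-! ### Generalization bound over a separable feature space -/

theorem rankingRisk01_le_integral_surrogateRankingLoss {𝒳 : Type*} [MeasurableSpace 𝒳] {c : ℕ}
    (D : Measure (𝒳 × Label c)) {ℓ : ℝ → ℝ} (hℓ : ∀ u, (if u ≤ 0 then (1 : ℝ) else 0) ≤ ℓ u)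
    {f : 𝒳 → Fin c → ℝ}
    (hf : Integrable (fun z : 𝒳 × Label c => surrogateRankingLoss ℓ (f z.1) z.2) D) :
    rankingRisk01 D f ≤ ∫ z, surrogateRankingLoss ℓ (f z.1) z.2 ∂D := by
  unfold rankingRisk01
  simp only [rankingLoss01_eq_surrogateRankingLoss]
  -- Only the larger function needs to be integrable, so the 0/1 loss requires no measurability
  -- argument.
  exact integral_mono_of_nonneg
    (Filter.Eventually.of_forall fun z =>
      surrogateRankingLoss_nonneg (fun u => by split_ifs <;> norm_num) _ _) hf
    (Filter.Eventually.of_forall fun z => surrogateRankingLoss_mono hℓ _ _)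

/-- The generalization bound for a separable feature space. -/
theorem exists_measurableSet_rankingRisk01_le {𝒳 : Type*} [MeasurableSpace 𝒳]
    {H : Type*} [NormedAddCommGroup H] [InnerProductSpace ℝ H] [SecondCountableTopology H]
    {c n : ℕ} (hc : 1 ≤ c) (hn : 1 ≤ n) {φ : 𝒳 → H}
    (hφm : ∀ w : H, Measurable fun x => (inner ℝ w (φ x) : ℝ))
    {Λ r : ℝ} (hr : 0 ≤ r) (hφ : ∀ x, ‖φ x‖ ^ 2 ≤ r ^ 2)
    {ℓ : ℝ → ℝ} (hℓ : ∀ u, (if u ≤ 0 then (1 : ℝ) else 0) ≤ ℓ u)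
    {ρ : ℝ≥0} (hρ : LipschitzWith ρ ℓ)
    {B : ℝ} (hB : ∀ f ∈ kernelClass c φ Λ, ∀ x p q, ℓ (f x p - f x q) ≤ B)
    (D : Measure (𝒳 × Label c)) [IsProbabilityMeasure D] {δ : ℝ} (hδ : 0 < δ) :
    ∃ E : Set (Fin n → 𝒳 × Label c), MeasurableSet E ∧
      ENNReal.ofReal (1 - δ) ≤ Measure.pi (fun _ : Fin n => D) E ∧
      ∀ S ∈ E, ∀ f ∈ kernelClass c φ Λ,
        rankingRisk01 D f ≤ empiricalRankingRisk ℓ S f + 2 * √2 * ρ * √(Λ ^ 2 * r ^ 2 / n)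
          + B * √(Real.log (1 / δ) / (2 * n)) := by
  rcases lt_or_ge Λ 0 with hΛ | hΛ
  -- A negative radius makes the class empty.
  · refine ⟨Set.univ, MeasurableSet.univ, ?_, fun S _ f hf => ?_⟩
    · rw [measure_univ, ← ENNReal.ofReal_one]
      exact ENNReal.ofReal_le_ofReal (by linarith)
    · obtain ⟨W, hW, -⟩ := hf
      exact absurd ((Real.sqrt_nonneg _).trans hW) (not_le.2 hΛ)
  have hn' : (0 : ℝ) < n := by exact_mod_cast hn
  have hℓ0 : ∀ u, 0 ≤ ℓ u := fun u => le_trans (by split_ifs <;> norm_num) (hℓ u)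
  set T := {W : PiLp 2 fun _ : Fin c => H // ‖W‖ ≤ Λ} with hT
  have : Nonempty T := ⟨⟨0, by simpa using hΛ⟩⟩
  -- The score difference of a label with itself is 0, and `1 ≤ ℓ 0`.
  have hB0 : 0 < B := by
    obtain ⟨z⟩ := nonempty_of_isProbabilityMeasure D
    have h1 := hB _ (kernelScore_mem_kernelClass φ (Classical.arbitrary T).2) z.1 ⟨0, hc⟩ ⟨0, hc⟩
    rw [sub_self] at h1
    have h2 := hℓ 0
    rw [if_pos le_rfl] at h2
    linarith
  set L : T → 𝒳 × Label c → ℝ := fun W z =>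
    surrogateRankingLoss ℓ (kernelScore φ W.1 z.1) z.2 with hL
  have hLm : ∀ W, Measurable (L W) := fun W =>
    measurable_surrogateRankingLoss hρ.continuous (measurable_pi_iff.2 fun j => hφm _)
  have hL0 : ∀ W z, 0 ≤ L W z := fun W z => surrogateRankingLoss_nonneg hℓ0 _ _
  have hLB : ∀ W z, L W z ≤ B := fun W z =>
    surrogateRankingLoss_le hc hB0.le (hB _ (kernelScore_mem_kernelClass φ W.2) z.1) _
  have hLabs : ∀ W z, |L W z| ≤ B := fun W z => by rw [abs_of_nonneg (hL0 W z)]; exact hLB W z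
  have hLc : ∀ z, Continuous fun W => L W z := fun z => by
    have hs : Continuous fun W : PiLp 2 fun _ : Fin c => H => kernelScore φ W z.1 := by
      unfold kernelScore
      fun_prop
    exact (continuous_surrogateRankingLoss hρ.continuous z.2).comp
      (hs.comp continuous_subtype_val)
  have hLic : Continuous fun W => ∫ z, L W z ∂D :=
    continuous_of_dominated (bound := fun _ => B) (fun W => (hLm W).aestronglyMeasurable)
      (fun W => Filter.Eventually.of_forall (hLabs W)) (integrable_const B)
      (Filter.Eventually.of_forall hLc)
  -- One event serves a dense sequence of weights; both sides are continuous in the weights, so the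
  -- bound extends to the whole ball on the same event.
  obtain ⟨E, hEm, hED, hE⟩ := exists_measurableSet_uniform_deviation_le D hn
    (g := fun k => L (TopologicalSpace.denseSeq T k)) (fun k => hLm _) hB0 (fun k => hL0 _)
    (fun k => hLB _)
    (fun S => sum_signedSup_surrogateRankingLoss_le hc hφ (W := fun k =>
      (TopologicalSpace.denseSeq T k).1) hΛ (fun k => (TopologicalSpace.denseSeq T k).2) hρ
      (fun k => hLabs _) S) hδ
  refine ⟨E, hEm, hED, fun S hS f hf => ?_⟩
  obtain ⟨W, hW, rfl⟩ := exists_eq_kernelScore_of_mem_kernelClass hf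
  have hall : n * ∫ z, L ⟨W, hW⟩ z ∂D ≤ ∑ i, L ⟨W, hW⟩ (S i) +
      2 * (Λ * √(n * (2 * (ρ * r) ^ 2))) + n * B * √(Real.log (1 / δ) / (2 * n)) := by
    refine (TopologicalSpace.denseRange_denseSeq T).induction_on
      (p := fun V : T => n * ∫ z, L V z ∂D ≤ ∑ i, L V (S i) +
        2 * (Λ * √(n * (2 * (ρ * r) ^ 2))) + n * B * √(Real.log (1 / δ) / (2 * n)))
      (⟨W, hW⟩ : T) (isClosed_le (continuous_const.mul hLic) ?_) (hE S hS)
    exact ((continuous_finsetSum _ fun i _ => hLc (S i)).add continuous_const).add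
      continuous_const
  have hrisk : rankingRisk01 D (kernelScore φ W) ≤ ∫ z, L ⟨W, hW⟩ z ∂D :=
    rankingRisk01_le_integral_surrogateRankingLoss D hℓ
      (integrable_of_measurable_of_abs_le (hLm ⟨W, hW⟩) (hLabs ⟨W, hW⟩))
  have hsqrt : Λ * √(n * (2 * (ρ * r) ^ 2)) = n * (√2 * ρ * √(Λ ^ 2 * r ^ 2 / n)) := by
    rw [← mul_assoc (n : ℝ) 2, Real.sqrt_mul (by positivity), Real.sqrt_mul (by positivity),
      Real.sqrt_sq (by positivity), ← mul_pow, Real.sqrt_div (by positivity),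
      Real.sqrt_sq (by positivity)]
    have := Real.sq_sqrt hn'.le
    field_simp
    rw [this]
    ring
  rw [hsqrt] at hall
  refine hrisk.trans (le_of_mul_le_mul_left (hall.trans (le_of_eq ?_)) hn')
  rw [empiricalRankingRisk, mul_add, mul_add, ← mul_assoc (n : ℝ) (1 / n),
    mul_one_div_cancel hn'.ne']
  ring

end MultiLabel

/-! ### Reduction to a separable feature space -/

theorem theorem6
    {𝒳 : Type*} [MeasurableSpace 𝒳]
    {H : Type*} [NormedAddCommGroup H] [InnerProductSpace ℝ H] [CompleteSpace H]
    -- numbers of labels and of data points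
    (c n : ℕ) (hc : 1 ≤ c) (hn : 1 ≤ n)
    -- positive semidefinite kernel with a (measurable) feature map into a Hilbert space
    (κ : 𝒳 → 𝒳 → ℝ) (hκ : Matrix.PosSemidef (Matrix.of κ : Matrix 𝒳 𝒳 ℝ))
    (φ : 𝒳 → H) (hφ : MultiLabel.IsFeatureMap κ φ) (hφm : StronglyMeasurable φ)
    (Λ r : ℝ) (hr : 0 < r) (hκr : ∀ x, κ x x ≤ r ^ 2)
    -- base loss: it dominates the 0/1 loss, is Lipschitz, and is bounded on the score differences
    (ℓ : ℝ → ℝ) (hℓ : ∀ u, (if u ≤ 0 then (1 : ℝ) else 0) ≤ ℓ u)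
    (ρ : ℝ≥0) (hρ : LipschitzWith ρ ℓ)
    (B : ℝ) (hB : ∀ f ∈ MultiLabel.kernelClass c φ Λ, ∀ x p q, ℓ (f x p - f x q) ≤ B)
    -- data distribution and confidence
    (D : Measure (𝒳 × MultiLabel.Label c)) [IsProbabilityMeasure D]
    (δ : ℝ) (hδ : 0 < δ) :
    ∃ E : Set (Fin n → 𝒳 × MultiLabel.Label c), MeasurableSet E ∧
      ENNReal.ofReal (1 - δ) ≤ Measure.pi (fun _ : Fin n => D) E ∧
      ∀ S ∈ E, ∀ f ∈ MultiLabel.kernelClass c φ Λ,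
        MultiLabel.rankingRisk01 D f ≤
          MultiLabel.empiricalRankingRisk ℓ S f
            + 2 * √2 * ρ * √(c * Λ ^ 2 * r ^ 2 / n)
            + 3 * B * √(Real.log (2 / δ) / (2 * n)) := by
  -- The range of a strongly measurable map is separable, hence so is `K`. Projecting the weights
  -- onto `K` leaves all scores unchanged and does not increase norms, so both spaces define the
  -- same class.
  set K : Submodule ℝ H := (Submodule.span ℝ (Set.range φ)).topologicalClosure with hK
  have hKsep : TopologicalSpace.IsSeparable (K : Set H) := by
    rw [hK, Submodule.topologicalClosure_coe]
    exact (hφm.isSeparable_range.span (R := ℝ)).closure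
  have : TopologicalSpace.SeparableSpace K := hKsep.separableSpace
  have : SecondCountableTopology K := UniformSpace.secondCountable_of_separable K
  have : CompleteSpace K := (Submodule.isClosed_topologicalClosure _).completeSpace_coe
  set φ' : 𝒳 → K := fun x =>
    ⟨φ x, Submodule.le_topologicalClosure _ (Submodule.subset_span ⟨x, rfl⟩)⟩ with hφ'
  have hsub : MultiLabel.kernelClass c φ' Λ ⊆ MultiLabel.kernelClass c φ Λ := by
    rintro f ⟨W, hW, rfl⟩
    exact ⟨fun j => W j, hW, rfl⟩
  have hsup : MultiLabel.kernelClass c φ Λ ⊆ MultiLabel.kernelClass c φ' Λ := by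
    rintro f ⟨W, hW, rfl⟩
    refine ⟨fun j => K.orthogonalProjectionOnto (W j), le_trans (Real.sqrt_le_sqrt ?_) hW, ?_⟩
    · refine Finset.sum_le_sum fun j _ => ?_
      gcongr
      exact K.norm_orthogonalProjectionOnto_apply_le (W j)
    · funext x j
      exact (K.inner_orthogonalProjectionOnto_eq_of_mem_right (φ' x) (W j)).symm
  obtain ⟨E, hEm, hED, hE⟩ := MultiLabel.exists_measurableSet_rankingRisk01_le hc hn (φ := φ')
    (Λ := Λ) (fun w => (stronglyMeasurable_const.inner hφm).measurable) hr.le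
    (fun x => by
      have := hκr x
      rwa [hφ x x, real_inner_self_eq_norm_sq] at this)
    hℓ hρ (fun f hf => hB f (hsub hf)) D hδ
  refine ⟨E, hEm, hED, fun S hS f hf => (hE S hS f (hsup hf)).trans ?_⟩
  have hB0 : 0 ≤ B := by
    obtain ⟨z⟩ := nonempty_of_isProbabilityMeasure D
    exact (le_trans (by split_ifs <;> norm_num) (hℓ _)).trans (hB f hf z.1 ⟨0, hc⟩ ⟨0, hc⟩)
  have hc' : (1 : ℝ) ≤ c := by exact_mod_cast hc
  -- The sharper bound is relaxed using `1 ≤ c`, `B ≤ 3 * B` and `1 / δ ≤ 2 / δ`.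
  gcongr
  · nlinarith [sq_nonneg Λ]
  · linarith
  · norm_num
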